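/- Let $p\in(0,1)$, let $(p_i)_{i\in\mathbb N}$ be rational numbers with $p_0=1$ and $p_i\in(0,1)$ for $i\ge 1$, and let $(s_i)_{i\in\mathbb N}$ be positive integers. Put $S_i=\sum_{j\le i}s_j$ and assume that $\prod_{i\in\mathbb N}p_i=p$ and that for all $i\in\mathbb N$: $p_i8^{s_i}\in\mathbb N$, $(1-p_{i+1})8^{S_i}\ge 7^{S_i}$, and $3\cdot 8^{S_i}\le s_{i+1}$. For $n\in\mathbb N$, a (dyadic) $n$-cube is a closed cube $\prod_{j=1}^{3}\left[\frac{a_j}{2^n},\frac{a_j+1}{2^n}\right]\subset\mathbb R^3$ with $a_j\in\{0,\dots,2^n-1\}$. Define random compact sets $\mathbb K_0\supseteq\mathbb K_1\supseteq\cdots$ as follows: $\mathbb K_0=[0,1]^3$, which is the union of all $S_0$-cubes; given $\mathbb K_i$, a union of $S_i$-cubes $L_0,\dots,L_{m-1}$, subdivide each $L_k$ into $8^{s_{i+1}}$ $S_{i+1}$-cubes, choose uniformly at random exactly $p_{i+1}8^{s_{i+1}}$ of them (all choices, in different cubes and at different stages, being independent), and let $\mathbb K_{i+1}$ be the union of all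 chosen $S_{i+1}$-cubes. Let $\mu$ be Lebesgue measure on $\mathbb R^3$. For $K\subseteq\mathbb R^3$ and $S\in\mathbb N$, say that $K$ contains a subcongruent $S$-cube if there is an $S$-cube $A$ with $\mu(A\cap K)>0$ and an isometry $\gamma\ne\mathrm{Id}$ of $\mathbb R^3$ such that $A\cap\gamma(A)=\emptyset$ and $\gamma(A\cap K)\subseteq K$. Then for every $S\in\mathbb N$ there is $i_0\in\mathbb N$ such that for all $i>i_0$ $$\Pr\left(\mathbb K_i\text{ contains a subcongruent }S\text{-cube}\right)<2^{-5^{S_i}}.$$ -/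

import Mathlib

open MeasureTheory Filter Topology

/-- Euclidean three-space. -/
abbrev E3 : Type := EuclideanSpace ℝ (Fin 3)

/-- The closed cube of side length `1 / 2 ^ n` whose lowest corner is `a / 2 ^ n`. -/
def dyadicCube (n : ℕ) (a : Fin 3 → ℕ) : Set E3 :=
  {x | ∀ j, (a j : ℝ) / 2 ^ n ≤ x j ∧ x j ≤ ((a j : ℝ) + 1) / 2 ^ n}

/-- The labels `a` of the `8 ^ n` dyadic `n`-cubes `dyadicCube n a` of the unit cube
(those whose corners all have coordinates among `0 / 2 ^ n, …, 2 ^ n / 2 ^ n`). -/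
def gridCubes (n : ℕ) : Finset (Fin 3 → ℕ) :=
  Fintype.piFinset fun _ => Finset.range (2 ^ n)

/-- `A` is a dyadic `n`-cube (contained in the unit cube). -/
def IsDyadicCube (n : ℕ) (A : Set E3) : Prop :=
  ∃ a ∈ gridCubes n, A = dyadicCube n a

/-- If `a` is the label of a dyadic `n`-cube, these are the labels of the `8 ^ s` dyadic
`(n + s)`-cubes into which it is subdivided. -/
def subcubes (s : ℕ) (a : Fin 3 → ℕ) : Finset (Fin 3 → ℕ) :=
  Fintype.piFinset fun j => Finset.Ico (2 ^ s * a j) (2 ^ s * (a j + 1))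

theorem card_subcubes (s : ℕ) (a : Fin 3 → ℕ) : (subcubes s a).card = 8 ^ s := by
  have h : ∀ j, 2 ^ s * (a j + 1) - 2 ^ s * a j = 2 ^ s := fun j => by
    rw [Nat.mul_add, Nat.mul_one, Nat.add_sub_cancel_left]
  simp only [subcubes, Fintype.card_piFinset, Nat.card_Ico, h, Finset.prod_const,
    Finset.card_univ, Fintype.card_fin]
  rw [← pow_mul, mul_comm, pow_mul]
  norm_num

/-- `A` is subcongruent in `K`: the set `A ∩ K` is not null and some nontrivial isometry `γ`
of the space moves `A` off itself and maps `A ∩ K` into `K`. -/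
def IsSubcongruentIn (A K : Set E3) : Prop :=
  0 < volume (A ∩ K) ∧
    ∃ γ : E3 ≃ᵢ E3, γ ≠ IsometryEquiv.refl E3 ∧ A ∩ γ '' A = ∅ ∧ γ '' (A ∩ K) ⊆ K

/-- `K` contains a subcongruent `S`-cube. -/
def ContainsSubcongruentCube (S : ℕ) (K : Set E3) : Prop :=
  ∃ A : Set E3, IsDyadicCube S A ∧ IsSubcongruentIn A K

/-- The parameters of the random set model: a number `lim = p ∈ (0,1)`, rational densities `p i`
(`p 0 = 1`, the others in `(0,1)`) with infinite product `lim`, and positive integers `s i`,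
subject to integrality and growth conditions, where `S i = s 0 + ⋯ + s i`. -/
structure SpongeParameters where
  lim : ℝ
  p : ℕ → ℚ
  s : ℕ → ℕ
  lim_mem : lim ∈ Set.Ioo (0 : ℝ) 1
  p_zero : p 0 = 1
  p_succ_mem : ∀ i, p (i + 1) ∈ Set.Ioo (0 : ℚ) 1
  s_pos : ∀ i, 0 < s i
  tendsto_prod : Tendsto (fun i : ℕ => ∏ j ∈ Finset.range (i + 1), (p j : ℝ)) atTop (𝓝 lim)
  integral : ∀ i, ∃ k : ℕ, p i * 8 ^ s i = k
  density : ∀ i, (7 : ℚ) ^ (∑ j ∈ Finset.range (i + 1), s j) ≤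
    (1 - p (i + 1)) * 8 ^ (∑ j ∈ Finset.range (i + 1), s j)
  growth : ∀ i, 3 * 8 ^ (∑ j ∈ Finset.range (i + 1), s j) ≤ s (i + 1)

namespace SpongeParameters

/-- `S i = s 0 + ⋯ + s i`. -/
def S (g : SpongeParameters) (i : ℕ) : ℕ := ∑ j ∈ Finset.range (i + 1), g.s j

/-- The number `p i * 8 ^ s i` of subcubes that are kept in each cube. -/
def keep (g : SpongeParameters) (i : ℕ) : ℕ := ⌊g.p i * 8 ^ g.s i⌋₊

theorem keep_cast (g : SpongeParameters) (i : ℕ) : (g.keep i : ℚ) = g.p i * 8 ^ g.s i := by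
  obtain ⟨k, hk⟩ := g.integral i
  rw [keep, hk, Nat.floor_natCast]

theorem keep_succ_le (g : SpongeParameters) (i : ℕ) : g.keep (i + 1) ≤ 8 ^ g.s (i + 1) := by
  have h : (g.keep (i + 1) : ℚ) ≤ ((8 ^ g.s (i + 1) : ℕ) : ℚ) := by
    rw [keep_cast]
    push_cast
    exact mul_le_of_le_one_left (by positivity) (g.p_succ_mem i).2.le
  exact_mod_cast h

/-- The possible choices in the `S i`-cube with label `a`, for `q = (i, a)`: all sets consisting of
exactly `p (i + 1) * 8 ^ s (i + 1)` of the `8 ^ s (i + 1)` dyadic `S (i + 1)`-cubes in it. -/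
abbrev Choice (g : SpongeParameters) (q : ℕ × (Fin 3 → ℕ)) : Type :=
  {F : Finset (Fin 3 → ℕ) //
    F ∈ Finset.powersetCard (g.keep (q.1 + 1)) (subcubes (g.s (q.1 + 1)) q.2)}

instance instNonemptyChoice (g : SpongeParameters) (q : ℕ × (Fin 3 → ℕ)) :
    Nonempty (g.Choice q) := by
  have h : (Finset.powersetCard (g.keep (q.1 + 1)) (subcubes (g.s (q.1 + 1)) q.2)).Nonempty := by
    rw [Finset.powersetCard_nonempty, card_subcubes]
    exact g.keep_succ_le q.1
  exact h.to_subtype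

instance instMeasurableSpaceChoice (g : SpongeParameters) (q : ℕ × (Fin 3 → ℕ)) :
    MeasurableSpace (g.Choice q) := ⊤

/-- The uniform distribution on the choices in one cube. -/
noncomputable def choiceLaw (g : SpongeParameters) (q : ℕ × (Fin 3 → ℕ)) :
    Measure (g.Choice q) :=
  (PMF.uniformOfFintype (g.Choice q)).toMeasure

instance instIsProbabilityMeasureChoiceLaw (g : SpongeParameters) (q : ℕ × (Fin 3 → ℕ)) :
    IsProbabilityMeasure (g.choiceLaw q) := by
  unfold choiceLaw
  infer_instance

/-- The probability measure: the choices in all cubes are uniform and independent. (A choice is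
attached to every cube of every level; only those in cubes that survive are used.) -/
noncomputable def prob (g : SpongeParameters) : Measure ((q : ℕ × (Fin 3 → ℕ)) → g.Choice q) :=
  Measure.infinitePi g.choiceLaw

/-- The labels of the `S i`-cubes that make up the random complex: all of them for `i = 0`, and
then those chosen in the cubes of the preceding stage. -/
def chosenCubes (g : SpongeParameters) (ω : (q : ℕ × (Fin 3 → ℕ)) → g.Choice q) :
    ℕ → Finset (Fin 3 → ℕ)
  | 0 => gridCubes (g.S 0)
  | i + 1 => (chosenCubes g ω i).biUnion fun a => (ω (i, a)).1

/-- The random dyadic `S i`-complex. -/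
def randomComplex (g : SpongeParameters) (i : ℕ) (ω : (q : ℕ × (Fin 3 → ℕ)) → g.Choice q) :
    Set E3 :=
  ⋃ a ∈ g.chosenCubes ω i, dyadicCube (g.S i) a

end SpongeParameters

/-! Put n = S_i and s = s_{i+1}, and take i so large that S ≤ n. A subcongruent S-cube A of K_{i+1}
contains a whole n-cube a of the preceding stage, and its isometry γ carries every subcube chosen in
a into K_{i+1}. Rounding γ turns it into a map φ of labels that sends chosen subcubes of a to chosen
cubes. Only 2^(12(n+s)+132) maps φ can occur, and φ is at most 125-to-one on these subcubes
(`exists_gridMap_of_image_subset`). By pigeonhole, some n-cube b receives at least a share 8^(-n) of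
the image, and b ≠ a because γ moves A off itself (`exists_absorbs_of_containsSubcongruentCube`).

For fixed a, b, φ, the choice in a prescribes a set T of at least lim · 8^s / (125 · 8^n) subcubes
of b, which the independent choice in b must contain. This has probability at most p_{i+1}^#T ≤
exp(-(1 - p_{i+1}) #T), and 1 - p_{i+1} ≥ (7/8)^n (`prob_absorbs_le`). A union bound over a, b, φ
finishes the proof: since s ≥ 3 · 8^n, the exponent, of order 8^s up to factors exponential in n,
dominates 5^(n+s) (`exists_forall_union_bound_lt`). -/

/-! ### Discretization of isometries on the dyadic grid -/

theorem EuclideanSpace.norm_le_two_mul_of_forall_abs_le {x : E3} {r : ℝ} (hr : 0 ≤ r)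
    (hx : ∀ j, |x j| ≤ r) : ‖x‖ ≤ 2 * r := by
  rw [EuclideanSpace.norm_eq, Real.sqrt_le_left (by positivity), Fin.sum_univ_three]
  have h : ∀ j, ‖x j‖ ^ 2 ≤ r ^ 2 := fun j => by
    rw [Real.norm_eq_abs]
    exact pow_le_pow_left₀ (abs_nonneg _) (hx j) 2
  nlinarith [h 0, h 1, h 2, sq_nonneg r]

theorem EuclideanSpace.abs_apply_le_norm (x : E3) (j : Fin 3) : |x j| ≤ ‖x‖ := by
  rw [← Real.norm_eq_abs]
  exact PiLp.norm_apply_le x j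

/-- An isometry of Euclidean space is determined affinely by the images of the origin and of the
standard basis. -/
theorem IsometryEquiv.apply_eq_add_sum (γ : E3 ≃ᵢ E3) (x : E3) (j : Fin 3) :
    γ x j = γ 0 j + ∑ k, x k * (γ (EuclideanSpace.single k 1) j - γ 0 j) := by
  set f := γ.toRealAffineIsometryEquiv
  have hf : ∀ y, γ y = f.linearIsometryEquiv y + γ 0 := fun y => by
    have := f.map_vadd (0 : E3) y
    simpa [f] using this
  have hx : x = ∑ k, x k • (EuclideanSpace.single k (1 : ℝ) : E3) := by
    ext l
    fin_cases l <;> simp [Fin.sum_univ_three]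
  have h0 : ∀ k, γ (EuclideanSpace.single k 1) j - γ 0 j
      = f.linearIsometryEquiv (EuclideanSpace.single k 1) j := fun k => by
    rw [hf (EuclideanSpace.single k 1)]
    simp
  simp only [h0]
  rw [hf x]
  conv_lhs => rw [hx]
  simp only [map_sum, map_smul, PiLp.add_apply]
  simp [Fin.sum_univ_three]
  ring

/-- The centre of a dyadic cube. -/
noncomputable def dyadicCenter (n : ℕ) (a : Fin 3 → ℕ) : E3 :=
  WithLp.toLp 2 fun j => ((a j : ℝ) + 1 / 2) / 2 ^ n

theorem dyadicCenter_apply (n : ℕ) (a : Fin 3 → ℕ) (j : Fin 3) :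
    dyadicCenter n a j = ((a j : ℝ) + 1 / 2) / 2 ^ n := rfl

theorem mem_dyadicCube_of_norm_sub_center_le {n : ℕ} {a : Fin 3 → ℕ} {w : E3}
    (hw : ‖w - dyadicCenter n a‖ ≤ 1 / 2 / 2 ^ n) : w ∈ dyadicCube n a := by
  intro j
  have h := abs_le.1 ((EuclideanSpace.abs_apply_le_norm _ j).trans hw)
  rw [PiLp.sub_apply, dyadicCenter_apply, add_div] at h
  rw [add_div]
  have h2 : (1 : ℝ) / 2 ^ n = 1 / 2 / 2 ^ n + 1 / 2 / 2 ^ n := by ring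
  constructor <;> linarith [h.1, h.2]

theorem dyadicCenter_mem_Icc {n : ℕ} {a : Fin 3 → ℕ} (ha : a ∈ gridCubes n) (j : Fin 3) :
    dyadicCenter n a j ∈ Set.Icc (0 : ℝ) 1 := by
  have h : a j < 2 ^ n := by simpa [gridCubes] using Fintype.mem_piFinset.1 ha j
  have h' : (a j : ℝ) + 1 ≤ 2 ^ n := by exact_mod_cast h
  rw [dyadicCenter_apply]
  constructor
  · positivity
  · rw [div_le_one (by positivity)]
    linarith

theorem mem_Icc_of_mem_dyadicCube {n : ℕ} {a : Fin 3 → ℕ} (ha : a ∈ gridCubes n) {x : E3}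
    (hx : x ∈ dyadicCube n a) (j : Fin 3) : x j ∈ Set.Icc (0 : ℝ) 1 := by
  have h : a j < 2 ^ n := by simpa [gridCubes] using Fintype.mem_piFinset.1 ha j
  have h' : (a j : ℝ) + 1 ≤ 2 ^ n := by exact_mod_cast h
  refine ⟨le_trans (by positivity) (hx j).1, (hx j).2.trans ?_⟩
  rw [div_le_one (by positivity)]
  linarith

/-- The affine map, evaluated at the centre of a cube and in units of `2 ^ (-n)`, that sends the
origin and the standard basis to prescribed multiples of `2 ^ (-n) / 128`. -/
noncomputable def gridAffine (n : ℕ) (t : Option (Fin 3) → Fin 3 → ℤ) (c : Fin 3 → ℕ) (j : Fin 3) :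
    ℝ :=
  (t none j + ∑ k, dyadicCenter n c k * (t (some k) j - t none j)) / 128

/-- The label of the cube into which `gridAffine` sends the centre of a cube. -/
noncomputable def gridMap (n : ℕ) (t : Option (Fin 3) → Fin 3 → ℤ) (c : Fin 3 → ℕ) : Fin 3 → ℕ :=
  fun j => ⌊gridAffine n t c j⌋.toNat

/-- The label maps of all discretized isometries that do not move the unit cube far away. -/
noncomputable def gridMaps (n : ℕ) : Finset ((Fin 3 → ℕ) → Fin 3 → ℕ) := by
  classical
  exact (Fintype.piFinset fun _ : Option (Fin 3) => Fintype.piFinset fun _ : Fin 3 =>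
    Finset.Icc (-(512 * 2 ^ n) : ℤ) (512 * 2 ^ n)).image (gridMap n)

/-- Four points with three coordinates each give twelve integers, each with at most 2^(n+11) values.
-/
theorem card_gridMaps_le (n : ℕ) : (gridMaps n).card ≤ 2 ^ (12 * n + 132) := by
  classical
  refine Finset.card_image_le.trans ?_
  simp only [Fintype.card_piFinset, Int.card_Icc, Finset.prod_const, Finset.card_univ,
    Fintype.card_fin, Fintype.card_option]
  have h : (512 * 2 ^ n + 1 - -(512 * 2 ^ n) : ℤ).toNat ≤ 2 ^ (n + 11) := by
    rw [Int.toNat_le, pow_add]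
    push_cast
    have : (1 : ℤ) ≤ 2 ^ n := one_le_pow₀ (by norm_num)
    linarith
  calc _ ≤ ((2 ^ (n + 11)) ^ 3) ^ 4 := by gcongr
    _ = 2 ^ (12 * n + 132) := by rw [← pow_mul, ← pow_mul]; congr 1; ring

/-- The discretization of an isometry. -/
noncomputable def gridIndex (n : ℕ) (γ : E3 ≃ᵢ E3) : Option (Fin 3) → Fin 3 → ℤ
  | none, j => ⌊γ 0 j * (128 * 2 ^ n)⌋
  | some k, j => ⌊γ (EuclideanSpace.single k 1) j * (128 * 2 ^ n)⌋

/-- Rounding down costs at most 1 in each entry of the index. The centre has coordinates in [0, 1],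
so the errors add up to at most 4, that is 4/128 after scaling. -/
theorem abs_gridAffine_sub_le (n : ℕ) (γ : E3 ≃ᵢ E3) {c : Fin 3 → ℕ} (hc : c ∈ gridCubes n)
    (j : Fin 3) :
    |gridAffine n (gridIndex n γ) c j - 2 ^ n * γ (dyadicCenter n c) j| ≤ 1 / 16 := by
  have hm := dyadicCenter_mem_Icc hc
  rw [IsometryEquiv.apply_eq_add_sum, gridAffine]
  set m := dyadicCenter n c
  have key : ∀ v : ℝ, ∃ e ∈ Set.Icc (0 : ℝ) 1, (⌊v * (128 * 2 ^ n)⌋ : ℝ) = v * (128 * 2 ^ n) - e :=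
    fun v => ⟨Int.fract (v * (128 * 2 ^ n)), ⟨Int.fract_nonneg _, (Int.fract_lt_one _).le⟩, by
      rw [Int.fract]; ring⟩
  simp only [gridIndex, Fin.sum_univ_three]
  obtain ⟨e, he, h⟩ := key (γ 0 j)
  obtain ⟨e0, he0, h0⟩ := key (γ (EuclideanSpace.single 0 1) j)
  obtain ⟨e1, he1, h1⟩ := key (γ (EuclideanSpace.single 1 1) j)
  obtain ⟨e2, he2, h2⟩ := key (γ (EuclideanSpace.single 2 1) j)
  rw [h, h0, h1, h2]
  have b : ∀ k : Fin 3, ∀ f ∈ Set.Icc (0 : ℝ) 1, |m k * (f - e)| ≤ 1 := fun k f hf => by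
    rw [abs_mul]
    have h1 : |m k| ≤ 1 := by rw [abs_of_nonneg (hm k).1]; exact (hm k).2
    have h2 : |f - e| ≤ 1 := by rw [abs_le]; constructor <;> linarith [hf.1, hf.2, he.1, he.2]
    exact mul_le_one₀ h1 (abs_nonneg _) h2
  have b0 := abs_le.1 (b 0 e0 he0)
  have b1 := abs_le.1 (b 1 e1 he1)
  have b2 := abs_le.1 (b 2 e2 he2)
  have : ∀ g g0 g1 g2 : ℝ, (g * (128 * 2 ^ n) - e +
        (m 0 * (g0 * (128 * 2 ^ n) - e0 - (g * (128 * 2 ^ n) - e)) +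
         m 1 * (g1 * (128 * 2 ^ n) - e1 - (g * (128 * 2 ^ n) - e)) +
         m 2 * (g2 * (128 * 2 ^ n) - e2 - (g * (128 * 2 ^ n) - e)))) / 128 -
      2 ^ n * (g + (m 0 * (g0 - g) + m 1 * (g1 - g) + m 2 * (g2 - g)))
      = -(e + m 0 * (e0 - e) + m 1 * (e1 - e) + m 2 * (e2 - e)) / 128 := by intros; ring
  rw [this, abs_le]
  constructor <;> linarith [he.1, he.2]

/-- The image cube contains a point well inside the grid cell of the rounded centre, so that cell
must belong to the covering family. In particular its label is nonnegative and `toNat` truncates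
nothing. -/
theorem gridMap_gridIndex_mem (n : ℕ) (γ : E3 ≃ᵢ E3) {c : Fin 3 → ℕ} (hc : c ∈ gridCubes n)
    {Q : Finset (Fin 3 → ℕ)} (h : γ '' dyadicCube n c ⊆ ⋃ d ∈ Q, dyadicCube n d) :
    (∀ j, ((gridMap n (gridIndex n γ) c j : ℕ) : ℤ) = ⌊gridAffine n (gridIndex n γ) c j⌋) ∧
    gridMap n (gridIndex n γ) c ∈ Q ∧
      (γ '' dyadicCube n c ∩ dyadicCube n (gridMap n (gridIndex n γ) c)).Nonempty := by
  set u := gridAffine n (gridIndex n γ) c with hu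
  have herr := abs_gridAffine_sub_le n γ hc
  -- Move a quarter of the way from u to the centre of its cell. In units of 2^(-n), each coordinate
  -- stays within 1/16 + 1/8 < 1/4 of the true image of the centre, hence in the inscribed ball of
  -- the image cube, and keeps distance at least 1/8 from the walls of the cell.
  set z : E3 := WithLp.toLp 2 fun j => (u j + (⌊u j⌋ + 1 / 2 - u j) / 4) / 2 ^ n with hz
  have hp : (0 : ℝ) < 2 ^ n := by positivity
  have hzu : ∀ j, 2 ^ n * z j = u j + (⌊u j⌋ + 1 / 2 - u j) / 4 := fun j => by
    simp only [hz]
    field_simp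
  have hzγ : z ∈ γ '' dyadicCube n c := by
    refine ⟨γ.symm z, mem_dyadicCube_of_norm_sub_center_le ?_, γ.apply_symm_apply z⟩
    rw [← dist_eq_norm, ← γ.isometry.dist_eq, γ.apply_symm_apply, dist_eq_norm]
    have : (1 : ℝ) / 2 / 2 ^ n = 2 * (1 / 4 / 2 ^ n) := by ring
    rw [this]
    refine EuclideanSpace.norm_le_two_mul_of_forall_abs_le (by positivity) fun j => ?_
    rw [le_div_iff₀ hp, ← abs_of_pos hp, ← abs_mul, PiLp.sub_apply, mul_comm,
      mul_sub, hzu]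
    have h1 := abs_le.1 (herr j)
    have h2 := Int.floor_le (u j)
    have h3 := Int.lt_floor_add_one (u j)
    rw [abs_le]
    constructor <;> linarith [h1.1, h1.2]
  obtain ⟨d, hd, hzd⟩ := Set.mem_iUnion₂.1 (h hzγ)
  have hdu : ∀ j, (d j : ℤ) = ⌊u j⌋ := fun j => by
    have h2 := Int.floor_le (u j)
    have h3 := Int.lt_floor_add_one (u j)
    have h4 := (hzd j).1
    have h5 := (hzd j).2
    rw [div_le_iff₀' hp, hzu] at h4
    rw [le_div_iff₀' hp, hzu] at h5
    have h6 : ((d j : ℤ) : ℝ) < ((⌊u j⌋ + 1 : ℤ) : ℝ) := by push_cast; linarith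
    have h7 : ((⌊u j⌋ : ℤ) : ℝ) < ((d j + 1 : ℤ) : ℝ) := by push_cast; linarith
    have := Int.cast_lt.1 h6
    have := Int.cast_lt.1 h7
    omega
  have hg : gridMap n (gridIndex n γ) c = d := by
    funext j
    rw [gridMap, ← hu, ← hdu j, Int.toNat_natCast]
  rw [hg]
  exact ⟨hdu, hd, z, hzγ, hzd⟩

/-- If two cubes share a label, the images of their centres differ by at most 1 + 2/16 < 5/4 grid
units per coordinate, so the centres are at most 5/2 units apart. Their labels then differ by at
most 2 in each coordinate, which leaves 5^3 = 125 candidates. -/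
theorem card_le_mul_card_image_gridMap (n : ℕ) (γ : E3 ≃ᵢ E3) {C : Finset (Fin 3 → ℕ)}
    (hC : C ⊆ gridCubes n)
    (h : ∀ c ∈ C, ∀ j,
      ((gridMap n (gridIndex n γ) c j : ℕ) : ℤ) = ⌊gridAffine n (gridIndex n γ) c j⌋) :
    C.card ≤ 125 * (C.image (gridMap n (gridIndex n γ))).card := by
  classical
  have hp : (0 : ℝ) < 2 ^ n := by positivity
  refine Finset.card_le_mul_card_image C 125 fun d hd => ?_
  obtain ⟨c, hc, rfl⟩ := Finset.mem_image.1 hd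
  have hsub : C.filter (fun x => gridMap n (gridIndex n γ) x = gridMap n (gridIndex n γ) c) ⊆
      Fintype.piFinset fun j => Finset.Icc (c j - 2) (c j + 2) := by
    intro c' hc'
    obtain ⟨hc', he⟩ := Finset.mem_filter.1 hc'
    rw [Fintype.mem_piFinset]
    intro j
    have hn : ‖dyadicCenter n c' - dyadicCenter n c‖ ≤ 2 * (5 / 4 / 2 ^ n) := by
      rw [← dist_eq_norm, ← γ.isometry.dist_eq, dist_eq_norm]
      refine EuclideanSpace.norm_le_two_mul_of_forall_abs_le (by positivity) fun k => ?_
      rw [le_div_iff₀ hp, ← abs_of_pos hp, ← abs_mul, PiLp.sub_apply, mul_comm,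
        mul_sub]
      have h1 := abs_le.1 (abs_gridAffine_sub_le n γ (hC hc) k)
      have h2 := abs_le.1 (abs_gridAffine_sub_le n γ (hC hc') k)
      have h3 : ⌊gridAffine n (gridIndex n γ) c' k⌋ = ⌊gridAffine n (gridIndex n γ) c k⌋ := by
        rw [← h c hc, ← h c' hc', he]
      have h4 := abs_lt.1 (Int.abs_sub_lt_one_of_floor_eq_floor h3)
      rw [abs_le]
      constructor <;> linarith [h1.1, h1.2, h2.1, h2.2, h4.1, h4.2]
    have hj := (EuclideanSpace.abs_apply_le_norm _ j).trans hn
    rw [PiLp.sub_apply, dyadicCenter_apply, dyadicCenter_apply, ← sub_div, abs_div,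
      abs_of_pos hp, ← mul_div_assoc, div_le_div_iff_of_pos_right hp] at hj
    have hj := abs_le.1 hj
    have h5 : ((c' j : ℕ) : ℝ) < ((c j + 3 : ℕ) : ℝ) := by push_cast; linarith [hj.2]
    have h6 : ((c j : ℕ) : ℝ) < ((c' j + 3 : ℕ) : ℝ) := by push_cast; linarith [hj.1]
    have := Nat.cast_lt.1 h5
    have := Nat.cast_lt.1 h6
    rw [Finset.mem_Icc]
    omega
  refine (Finset.card_le_card hsub).trans ?_
  rw [Fintype.card_piFinset]
  calc _ ≤ ∏ _j : Fin 3, 5 := Finset.prod_le_prod' fun j _ => by rw [Nat.card_Icc]; omega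
    _ = 125 := by simp

/-- The origin and the basis vectors lie within 2 of x, so their images have coordinates in [-2, 3].
-/
theorem gridMap_gridIndex_mem_gridMaps (n : ℕ) (γ : E3 ≃ᵢ E3) {x : E3}
    (hx : ∀ j, x j ∈ Set.Icc (0 : ℝ) 1) (hγx : ∀ j, γ x j ∈ Set.Icc (0 : ℝ) 1) :
    gridMap n (gridIndex n γ) ∈ gridMaps n := by
  classical
  have hp : (0 : ℝ) < 2 ^ n := by positivity
  have key : ∀ v : E3, (∀ j, v j ∈ Set.Icc (0 : ℝ) 1) → ∀ j,
      ⌊γ v j * (128 * 2 ^ n)⌋ ∈ Finset.Icc (-(512 * 2 ^ n) : ℤ) (512 * 2 ^ n) := by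
    intro v hv j
    have hn : ‖γ v - γ x‖ ≤ 2 * 1 := by
      rw [← dist_eq_norm, γ.isometry.dist_eq, dist_eq_norm]
      refine EuclideanSpace.norm_le_two_mul_of_forall_abs_le zero_le_one fun k => ?_
      rw [PiLp.sub_apply, abs_le]
      constructor <;> linarith [(hv k).1, (hv k).2, (hx k).1, (hx k).2]
    have hj := abs_le.1 ((EuclideanSpace.abs_apply_le_norm _ j).trans hn)
    rw [PiLp.sub_apply] at hj
    rw [Finset.mem_Icc, Int.le_floor, ← Int.cast_le (R := ℝ)]
    have h1 := (hγx j).1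
    have h2 := (hγx j).2
    push_cast
    constructor
    · nlinarith [hj.1]
    · refine (Int.floor_le _).trans ?_
      nlinarith [hj.2]
  refine Finset.mem_image_of_mem _ ?_
  rw [Fintype.mem_piFinset]
  intro o
  rw [Fintype.mem_piFinset]
  intro j
  cases o with
  | none => exact key 0 (fun k => by simp) j
  | some k =>
    refine key _ (fun l => ?_) j
    by_cases hl : l = k <;> simp [hl]

/-- An isometry that maps a union of grid cubes into another one induces one of finitely many maps
between the labels of these cubes, and this map is at most `125`-to-one. -/
theorem exists_gridMap_of_image_subset (n : ℕ) (γ : E3 ≃ᵢ E3) {C Q : Finset (Fin 3 → ℕ)}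
    (hC : C ⊆ gridCubes n) (hQ : Q ⊆ gridCubes n) (hne : C.Nonempty)
    (h : ∀ c ∈ C, γ '' dyadicCube n c ⊆ ⋃ d ∈ Q, dyadicCube n d) :
    ∃ φ ∈ gridMaps n, C.card ≤ 125 * (C.image φ).card ∧
      ∀ c ∈ C, φ c ∈ Q ∧ (γ '' dyadicCube n c ∩ dyadicCube n (φ c)).Nonempty := by
  refine ⟨gridMap n (gridIndex n γ), ?_, ?_, fun c hc =>
    (gridMap_gridIndex_mem n γ (hC hc) (h c hc)).2⟩
  · obtain ⟨c, hc⟩ := hne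
    have hm : dyadicCenter n c ∈ dyadicCube n c :=
      mem_dyadicCube_of_norm_sub_center_le (by simp; positivity)
    obtain ⟨d, hd, hmd⟩ := Set.mem_iUnion₂.1 (h c hc (Set.mem_image_of_mem γ hm))
    exact gridMap_gridIndex_mem_gridMaps n γ (dyadicCenter_mem_Icc (hC hc))
      (mem_Icc_of_mem_dyadicCube (hQ hd) hmd)
  · exact card_le_mul_card_image_gridMap n γ hC fun c hc =>
      (gridMap_gridIndex_mem n γ (hC hc) (h c hc)).1
-- Combinatorics and nesting of dyadic cubes
theorem mem_gridCubes {n : ℕ} {a : Fin 3 → ℕ} : a ∈ gridCubes n ↔ ∀ j, a j < 2 ^ n := by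
  simp [gridCubes, Fintype.mem_piFinset]

theorem mem_subcubes {s : ℕ} {a c : Fin 3 → ℕ} :
    c ∈ subcubes s a ↔ ∀ j, 2 ^ s * a j ≤ c j ∧ c j < 2 ^ s * (a j + 1) := by
  simp [subcubes, Fintype.mem_piFinset]

theorem card_gridCubes (n : ℕ) : (gridCubes n).card = 8 ^ n := by
  simp only [gridCubes, Fintype.card_piFinset, Finset.card_range, Finset.prod_const,
    Finset.card_univ, Fintype.card_fin]
  rw [← pow_mul, mul_comm, pow_mul]
  norm_num

theorem subcubes_subset_gridCubes {n s : ℕ} {a : Fin 3 → ℕ} (ha : a ∈ gridCubes n) :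
    subcubes s a ⊆ gridCubes (n + s) := by
  intro c hc
  rw [mem_gridCubes] at ha ⊢
  rw [mem_subcubes] at hc
  intro j
  calc c j < 2 ^ s * (a j + 1) := (hc j).2
    _ ≤ 2 ^ s * 2 ^ n := Nat.mul_le_mul_left _ (ha j)
    _ = 2 ^ (n + s) := by rw [pow_add, mul_comm]

theorem eq_of_mem_subcubes {s : ℕ} {a b c : Fin 3 → ℕ} (ha : c ∈ subcubes s a)
    (hb : c ∈ subcubes s b) : a = b := by
  rw [mem_subcubes] at ha hb
  funext j
  have h1 := Nat.lt_of_mul_lt_mul_left ((ha j).1.trans_lt (hb j).2)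
  have h2 := Nat.lt_of_mul_lt_mul_left ((hb j).1.trans_lt (ha j).2)
  omega

theorem dyadicCube_subset_of_mem_subcubes {n s : ℕ} {a c : Fin 3 → ℕ} (hc : c ∈ subcubes s a) :
    dyadicCube (n + s) c ⊆ dyadicCube n a := by
  rw [mem_subcubes] at hc
  intro x hx j
  have h1 : (2 ^ s * a j : ℝ) ≤ c j := by exact_mod_cast (hc j).1
  have h2 : (c j + 1 : ℝ) ≤ 2 ^ s * (a j + 1) := by exact_mod_cast (hc j).2
  have hs : (0 : ℝ) < 2 ^ s := by positivity
  refine ⟨le_trans ?_ (hx j).1, (hx j).2.trans ?_⟩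
  · rw [pow_add, div_le_div_iff₀ (by positivity) (by positivity)]
    calc (a j : ℝ) * (2 ^ n * 2 ^ s) = 2 ^ s * a j * 2 ^ n := by ring
      _ ≤ _ := by gcongr
  · rw [pow_add, div_le_div_iff₀ (by positivity) (by positivity)]
    calc ((c j : ℝ) + 1) * 2 ^ n ≤ 2 ^ s * (a j + 1) * 2 ^ n := by gcongr
      _ = _ := by ring

theorem volume_coordinate_hyperplane (j : Fin 3) (r : ℝ) : volume {x : E3 | x j = r} = 0 := by
  have h : {x : E3 | x j = r} = (WithLp.ofLp : E3 → Fin 3 → ℝ) ⁻¹' {x | x j = r} := rfl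
  have hm : MeasurableSet {x : Fin 3 → ℝ | x j = r} :=
    measurableSet_eq_fun (measurable_pi_apply j) measurable_const
  rw [h, (PiLp.volume_preserving_ofLp (Fin 3)).measure_preimage hm.nullMeasurableSet]
  exact Measure.pi_hyperplane (fun _ : Fin 3 => (volume : Measure ℝ)) j r

/-- Two dyadic cubes with an essential intersection are nested. -/
theorem mem_subcubes_of_volume_inter_pos {n s : ℕ} {a c : Fin 3 → ℕ}
    (h : 0 < volume (dyadicCube n a ∩ dyadicCube (n + s) c)) : c ∈ subcubes s a := by
  have hs : (0 : ℝ) < 2 ^ s := by positivity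
  have hn : (0 : ℝ) < 2 ^ n := by positivity
  have hns : (0 : ℝ) < 2 ^ (n + s) := by positivity
  rw [mem_subcubes]
  intro j
  constructor
  · by_contra! hj
    have hj' : (c j + 1 : ℝ) ≤ 2 ^ s * a j := by exact_mod_cast hj
    refine h.ne' (measure_mono_null ?_ (volume_coordinate_hyperplane j (a j / 2 ^ n)))
    rintro x ⟨hx, hy⟩
    refine le_antisymm ((hy j).2.trans ?_) (hx j).1
    rw [pow_add, div_le_div_iff₀ (by positivity) hn]
    calc ((c j : ℝ) + 1) * 2 ^ n ≤ 2 ^ s * a j * 2 ^ n := by gcongr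
      _ = _ := by ring
  · by_contra! hj
    have hj' : (2 ^ s * (a j + 1) : ℝ) ≤ c j := by exact_mod_cast hj
    refine h.ne' (measure_mono_null ?_ (volume_coordinate_hyperplane j ((a j + 1) / 2 ^ n)))
    rintro x ⟨hx, hy⟩
    refine le_antisymm (hx j).2 (le_trans ?_ (hy j).1)
    rw [pow_add, div_le_div_iff₀ hn (by positivity)]
    calc ((a j : ℝ) + 1) * (2 ^ n * 2 ^ s) = 2 ^ s * (a j + 1) * 2 ^ n := by ring
      _ ≤ _ := by gcongr

/-! ### From a subcongruent cube to a coincidence between two choices -/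

namespace SpongeParameters

theorem S_succ (g : SpongeParameters) (i : ℕ) : g.S (i + 1) = g.S i + g.s (i + 1) :=
  Finset.sum_range_succ _ _

theorem lt_S (g : SpongeParameters) (i : ℕ) : i < g.S i := by
  induction i with
  | zero => simpa [S] using g.s_pos 0
  | succ i ih => have := g.s_pos (i + 1); rw [S_succ]; omega

theorem choice_subset (g : SpongeParameters) {q : ℕ × (Fin 3 → ℕ)} (F : g.Choice q) :
    F.1 ⊆ subcubes (g.s (q.1 + 1)) q.2 := (Finset.mem_powersetCard.1 F.2).1

theorem card_choice (g : SpongeParameters) {q : ℕ × (Fin 3 → ℕ)} (F : g.Choice q) :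
    F.1.card = g.keep (q.1 + 1) := (Finset.mem_powersetCard.1 F.2).2

theorem keep_pos (g : SpongeParameters) (i : ℕ) : 0 < g.keep (i + 1) := by
  have h : (0 : ℚ) < g.keep (i + 1) := by
    rw [keep_cast]
    have := (g.p_succ_mem i).1
    positivity
  exact_mod_cast h

theorem mem_chosenCubes_succ {g : SpongeParameters} {ω : (q : ℕ × (Fin 3 → ℕ)) → g.Choice q}
    {i : ℕ} {d : Fin 3 → ℕ} :
    d ∈ g.chosenCubes ω (i + 1) ↔ ∃ a ∈ g.chosenCubes ω i, d ∈ (ω (i, a)).1 := by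
  rw [chosenCubes, Finset.mem_biUnion]

theorem chosenCubes_subset (g : SpongeParameters) (ω : (q : ℕ × (Fin 3 → ℕ)) → g.Choice q)
    (i : ℕ) : g.chosenCubes ω i ⊆ gridCubes (g.S i) := by
  induction i with
  | zero => exact subset_rfl
  | succ i ih =>
    rw [chosenCubes, Finset.biUnion_subset]
    intro a ha
    rw [S_succ]
    exact (g.choice_subset (ω (i, a))).trans (subcubes_subset_gridCubes (ih ha))

/-- The set `G`, chosen in the cube `b`, contains the part in `b` of the image of `F` under `φ`, and
this part is large. -/
def Absorbs (g : SpongeParameters) (i : ℕ) (b : Fin 3 → ℕ) (φ : (Fin 3 → ℕ) → Fin 3 → ℕ)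
    (F G : Finset (Fin 3 → ℕ)) : Prop :=
  g.keep (i + 1) ≤ 125 * 8 ^ g.S i * (F.image φ ∩ subcubes (g.s (i + 1)) b).card ∧
    F.image φ ∩ subcubes (g.s (i + 1)) b ⊆ G

/-- This replaces the uncountable family of isometries by finitely many events, each involving only
the choices in two distinct cubes. -/
theorem exists_absorbs_of_containsSubcongruentCube (g : SpongeParameters) {S i : ℕ}
    (hS : S ≤ g.S i) (ω : (q : ℕ × (Fin 3 → ℕ)) → g.Choice q)
    (h : ContainsSubcongruentCube S (g.randomComplex (i + 1) ω)) :
    ∃ a ∈ gridCubes (g.S i), ∃ b ∈ gridCubes (g.S i), ∃ φ ∈ gridMaps (g.S (i + 1)),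
      a ≠ b ∧ g.Absorbs i b φ (ω (i, a)).1 (ω (i, b)).1 := by
  obtain ⟨A, ⟨α, hα, rfl⟩, hpos, γ, -, hdisj, hγ⟩ := h
  obtain ⟨c, hc, hcpos⟩ : ∃ c ∈ g.chosenCubes ω (i + 1),
      0 < volume (dyadicCube S α ∩ dyadicCube (g.S (i + 1)) c) := by
    by_contra! hnull
    refine hpos.ne' ?_
    rw [randomComplex, Set.inter_iUnion₂]
    refine (measure_biUnion_null_iff (Finset.countable_toSet (g.chosenCubes ω (i + 1)))).2 ?_
    exact fun c hc => nonpos_iff_eq_zero.1 (hnull c hc)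
  obtain ⟨a, ha, hca⟩ := mem_chosenCubes_succ.1 hc
  obtain ⟨m, hm⟩ := Nat.exists_eq_add_of_le hS
  have hca' := g.choice_subset (ω (i, a)) hca
  have haα : a ∈ subcubes m α := by
    refine mem_subcubes_of_volume_inter_pos (n := S) (hcpos.trans_le (measure_mono ?_))
    rw [← hm]
    refine Set.inter_subset_inter_right _ ?_
    rw [S_succ]
    exact dyadicCube_subset_of_mem_subcubes hca'
  have hsubA : ∀ d ∈ subcubes (g.s (i + 1)) a,
      dyadicCube (g.S (i + 1)) d ⊆ dyadicCube S α := by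
    intro d hd
    rw [S_succ]
    refine (dyadicCube_subset_of_mem_subcubes hd).trans ?_
    rw [hm]
    exact dyadicCube_subset_of_mem_subcubes haα
  have hF : (ω (i, a)).1 ⊆ subcubes (g.s (i + 1)) a := g.choice_subset (ω (i, a))
  have hFch : (ω (i, a)).1 ⊆ g.chosenCubes ω (i + 1) := by
    rw [chosenCubes]
    exact Finset.subset_biUnion_of_mem (fun a => (ω (i, a)).1) ha
  have hch := g.chosenCubes_subset ω (i + 1)
  obtain ⟨φ, hφ, hcard, himg⟩ := exists_gridMap_of_image_subset (g.S (i + 1)) γ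
    (hFch.trans hch) hch ⟨c, hca⟩ (fun d hd => by
      refine (Set.image_mono ?_).trans hγ
      exact Set.subset_inter (hsubA d (hF hd))
        (Set.subset_biUnion_of_mem (u := fun a => dyadicCube (g.S (i + 1)) a) (hFch hd)))
  have hcov : (ω (i, a)).1.image φ ⊆ (gridCubes (g.S i)).biUnion fun b =>
      (ω (i, a)).1.image φ ∩ subcubes (g.s (i + 1)) b := by
    intro d hd
    obtain ⟨e, he, rfl⟩ := Finset.mem_image.1 hd
    obtain ⟨b, hb, hdb⟩ := mem_chosenCubes_succ.1 (himg e he).1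
    have hbsub : (ω (i, b)).1 ⊆ subcubes (g.s (i + 1)) b := g.choice_subset (ω (i, b))
    exact Finset.mem_biUnion.2 ⟨b, g.chosenCubes_subset ω i hb,
      Finset.mem_inter.2 ⟨hd, hbsub hdb⟩⟩
  -- Pigeonhole: b is the cube that receives the largest part of the image.
  obtain ⟨b, hb, hbcard⟩ : ∃ b ∈ gridCubes (g.S i), ((ω (i, a)).1.image φ).card ≤
      8 ^ g.S i * ((ω (i, a)).1.image φ ∩ subcubes (g.s (i + 1)) b).card := by
    obtain ⟨b, hb, hmax⟩ := Finset.exists_max_image (gridCubes (g.S i))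
      (fun b => ((ω (i, a)).1.image φ ∩ subcubes (g.s (i + 1)) b).card)
      ⟨a, g.chosenCubes_subset ω i ha⟩
    refine ⟨b, hb, (Finset.card_le_card hcov).trans ?_⟩
    rw [← card_gridCubes]
    exact Finset.card_biUnion_le_card_mul _ _ _ hmax
  rw [g.card_choice] at hcard
  have hkeep : g.keep (i + 1) ≤
      125 * 8 ^ g.S i * ((ω (i, a)).1.image φ ∩ subcubes (g.s (i + 1)) b).card := by
    calc _ ≤ _ := hcard
      _ ≤ 125 * (8 ^ g.S i * _) := Nat.mul_le_mul_left _ hbcard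
      _ = _ := by ring
  refine ⟨a, g.chosenCubes_subset ω i ha, b, hb, φ, hφ, ?_, hkeep, ?_⟩
  -- If b = a, some subcube of a has an image under γ that meets a subcube of a, so A meets its own
  -- image.
  · rintro rfl
    have hne : 0 < ((ω (i, a)).1.image φ ∩ subcubes (g.s (i + 1)) a).card :=
      Nat.pos_of_mul_pos_left ((g.keep_pos i).trans_le hkeep)
    obtain ⟨d, hd⟩ := Finset.card_pos.1 hne
    obtain ⟨hd, hda⟩ := Finset.mem_inter.1 hd
    obtain ⟨e, he, rfl⟩ := Finset.mem_image.1 hd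
    obtain ⟨z, hz1, hz2⟩ := (himg e he).2
    have : z ∈ dyadicCube S α ∩ γ '' dyadicCube S α :=
      ⟨hsubA _ hda hz2, Set.image_mono (hsubA _ (hF he)) hz1⟩
    rw [hdisj] at this
    exact this
  · intro d hd
    obtain ⟨hd, hdb⟩ := Finset.mem_inter.1 hd
    obtain ⟨e, he, rfl⟩ := Finset.mem_image.1 hd
    obtain ⟨b', -, hdb'⟩ := mem_chosenCubes_succ.1 (himg e he).1
    have hbsub : (ω (i, b')).1 ⊆ subcubes (g.s (i + 1)) b' := g.choice_subset (ω (i, b'))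
    obtain rfl := eq_of_mem_subcubes hdb (hbsub hdb')
    exact hdb'

end SpongeParameters
-- Independence and uniformly random subsets
/-- In a product measure, the conditional bound on one coordinate, given another one with finitely
many values, is an unconditional bound. -/
theorem MeasureTheory.Measure.infinitePi_pair_le {ι : Type*} {X : ι → Type*}
    [∀ i, MeasurableSpace (X i)] (μ : (i : ι) → Measure (X i)) [∀ i, IsProbabilityMeasure (μ i)]
    {a b : ι} (hab : a ≠ b) [Fintype (X a)] [MeasurableSingletonClass (X a)]
    (B : X a → Set (X b)) (hB : ∀ x, MeasurableSet (B x)) {ε : ENNReal}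
    (h : ∀ x, μ b (B x) ≤ ε) :
    Measure.infinitePi μ {ω | ω b ∈ B (ω a)} ≤ ε := by
  classical
  let t : X a → (i : ι) → Set (X i) := fun x =>
    Function.update (Function.update (fun _ => Set.univ) a {x}) b (B x)
  have hta : ∀ x, t x a = {x} := fun x => by simp [t, Function.update_of_ne hab]
  have htb : ∀ x, t x b = B x := fun x => by simp [t]
  -- Splitting by the value at a covers the event by finitely many cylinders over a and b, whose
  -- measures factor.
  have hsub : {ω : (i : ι) → X i | ω b ∈ B (ω a)} ⊆
      ⋃ x ∈ (Finset.univ : Finset (X a)), Set.pi (({a, b} : Finset ι) : Set ι) (t x) := by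
    intro ω hω
    refine Set.mem_iUnion₂.2 ⟨ω a, Finset.mem_univ _, ?_⟩
    intro i hi
    rcases Finset.mem_insert.1 (Finset.mem_coe.1 hi) with rfl | hi
    · rw [hta]; rfl
    · obtain rfl := Finset.mem_singleton.1 hi
      rw [htb]; exact hω
  have hpi : ∀ x, Measure.infinitePi μ (Set.pi (({a, b} : Finset ι) : Set ι) (t x)) =
      μ a {x} * μ b (B x) := fun x => by
    rw [Measure.infinitePi_pi, Finset.prod_pair hab, hta, htb]
    intro i hi
    rcases Finset.mem_insert.1 hi with rfl | hi
    · rw [hta]; exact measurableSet_singleton x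
    · obtain rfl := Finset.mem_singleton.1 hi
      rw [htb]; exact hB x
  calc _ ≤ _ := measure_mono hsub
    _ ≤ ∑ x, Measure.infinitePi μ (Set.pi (({a, b} : Finset ι) : Set ι) (t x)) :=
      measure_biUnion_finset_le _ _
    _ ≤ ∑ x, μ a {x} * ε := Finset.sum_le_sum fun x _ => by
      rw [hpi]; gcongr; exact h x
    _ = ε := by
      rw [← Finset.sum_mul, sum_measure_singleton, Finset.coe_univ, measure_univ, one_mul]

/-- The ratio of the binomials is the product of (k - j)/(N - j) over j < M, and each factor is at
most k/N. -/
theorem Nat.choose_sub_mul_pow_le {N k : ℕ} (hk : k ≤ N) {M : ℕ} (hM : M ≤ k) :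
    (N - M).choose (k - M) * N ^ M ≤ N.choose k * k ^ M := by
  induction M with
  | zero => simp
  | succ M ih =>
    obtain ⟨u, rfl⟩ := Nat.exists_eq_add_of_le hM
    obtain ⟨v, rfl⟩ := Nat.exists_eq_add_of_le (hM.trans hk)
    have huv : u ≤ v := by omega
    have h1 : M + 1 + v - (M + 1) = v := by omega
    have h2 : M + 1 + u - (M + 1) = u := by omega
    have h3 : M + 1 + v - M = v + 1 := by omega
    have h4 : M + 1 + u - M = u + 1 := by omega
    have ih := ih (by omega)
    rw [h3, h4] at ih
    rw [h1, h2]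
    have hstep : v.choose u * (M + 1 + v) ≤ (v + 1).choose (u + 1) * (M + 1 + u) := by
      refine Nat.le_of_mul_le_mul_left ?_ v.succ_pos
      have he := Nat.add_one_mul_choose_eq v u
      calc v.succ * (v.choose u * (M + 1 + v)) = (v.succ * v.choose u) * (M + 1 + v) := by ring
        _ = (v + 1).choose (u + 1) * ((u + 1) * (M + 1 + v)) := by rw [he]; ring
        _ ≤ (v + 1).choose (u + 1) * (v.succ * (M + 1 + u)) := by
          refine Nat.mul_le_mul_left _ ?_
          rw [Nat.succ_eq_add_one]
          nlinarith
        _ = _ := by ring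
    calc v.choose u * (M + 1 + v) ^ (M + 1)
        = (v.choose u * (M + 1 + v)) * (M + 1 + v) ^ M := by ring
      _ ≤ ((v + 1).choose (u + 1) * (M + 1 + u)) * (M + 1 + v) ^ M :=
        Nat.mul_le_mul_right _ hstep
      _ = ((v + 1).choose (u + 1) * (M + 1 + v) ^ M) * (M + 1 + u) := by ring
      _ ≤ ((M + 1 + v).choose (M + 1 + u) * (M + 1 + u) ^ M) * (M + 1 + u) :=
        Nat.mul_le_mul_right _ ih
      _ = _ := by ring

/-- A uniformly random subset of given size contains a given set of `#T` elements with probability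
at most the density to the power `#T`. -/
theorem card_filter_powersetCard_subset_mul_le {α : Type*} [DecidableEq α] {U T : Finset α}
    (hT : T ⊆ U) {k : ℕ} (hk : k ≤ U.card) :
    ((U.powersetCard k).filter (T ⊆ ·)).card * U.card ^ T.card ≤
      (U.powersetCard k).card * k ^ T.card := by
  rcases le_or_gt T.card k with h | h
  · rw [Finset.card_filter_powersetCard_subset _ _ _ hT h, Finset.card_powersetCard]
    exact Nat.choose_sub_mul_pow_le hk h
  · rw [Finset.card_eq_zero.2, zero_mul]
    · exact Nat.zero_le _
    · rw [Finset.filter_eq_empty_iff]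
      intro F hF hTF
      rw [Finset.mem_powersetCard] at hF
      have := Finset.card_le_card hTF
      omega

/-! ### Probability estimates and the union bound -/

namespace SpongeParameters

theorem choiceLaw_superset_le (g : SpongeParameters) (q : ℕ × (Fin 3 → ℕ))
    {T : Finset (Fin 3 → ℕ)} (hT : T ⊆ subcubes (g.s (q.1 + 1)) q.2) :
    g.choiceLaw q {G | T ⊆ G.1} ≤
      ENNReal.ofReal (Real.exp (-((1 - g.p (q.1 + 1)) * T.card))) := by
  classical
  set P := Finset.powersetCard (g.keep (q.1 + 1)) (subcubes (g.s (q.1 + 1)) q.2) with hP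
  have hU : (subcubes (g.s (q.1 + 1)) q.2).card = 8 ^ g.s (q.1 + 1) := card_subcubes _ _
  have hcount := card_filter_powersetCard_subset_mul_le hT (hU ▸ g.keep_succ_le q.1)
  rw [hU, ← hP] at hcount
  have hPpos : 0 < P.card := by
    rw [hP, Finset.card_pos, Finset.powersetCard_nonempty, hU]
    exact g.keep_succ_le q.1
  have hcard : Fintype.card {G : g.Choice q | T ⊆ G.1} ≤ (P.filter (T ⊆ ·)).card := by
    rw [← Set.toFinset_card]
    refine Finset.card_le_card_of_injOn Subtype.val (fun G hG => ?_) Subtype.val_injective.injOn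
    have hG' : T ⊆ G.1 := by simpa using hG
    exact Finset.mem_coe.2 (Finset.mem_filter.2 ⟨G.2, hG'⟩)
  have hcardP : Fintype.card (g.Choice q) = P.card := Fintype.card_coe P
  rw [choiceLaw, PMF.toMeasure_uniformOfFintype_apply _ MeasurableSpace.measurableSet_top, hcardP]
  have hNpos : (0 : ℝ) < 8 ^ g.s (q.1 + 1) := by positivity
  have hPpos' : (0 : ℝ) < P.card := by exact_mod_cast hPpos
  have hkeep : (g.keep (q.1 + 1) : ℝ) = g.p (q.1 + 1) * 8 ^ g.s (q.1 + 1) := by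
    exact_mod_cast congrArg (Rat.cast : ℚ → ℝ) (g.keep_cast (q.1 + 1))
  have hreal : (Fintype.card {G : g.Choice q | T ⊆ G.1} : ℝ) / P.card ≤
      Real.exp (-((1 - g.p (q.1 + 1)) * T.card)) := by
    have h1 : (((P.filter (T ⊆ ·)).card : ℕ) : ℝ) * (8 ^ g.s (q.1 + 1)) ^ T.card ≤
        P.card * (g.p (q.1 + 1) * 8 ^ g.s (q.1 + 1)) ^ T.card := by
      rw [← hkeep]; exact_mod_cast hcount
    have hp0 : (0 : ℝ) ≤ g.p (q.1 + 1) := by exact_mod_cast (g.p_succ_mem q.1).1.le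
    calc _ ≤ (((P.filter (T ⊆ ·)).card : ℕ) : ℝ) / P.card := by gcongr
      _ ≤ (g.p (q.1 + 1) : ℝ) ^ T.card := by
        rw [div_le_iff₀ hPpos']
        refine le_of_mul_le_mul_right (h1.trans_eq ?_) (pow_pos hNpos T.card)
        rw [mul_pow]; ring
      _ ≤ (Real.exp (-(1 - g.p (q.1 + 1)))) ^ T.card := by
        gcongr
        have := Real.add_one_le_exp (-(1 - (g.p (q.1 + 1) : ℝ)))
        linarith
      _ = _ := by rw [← Real.exp_nat_mul]; congr 1; ring
  refine le_trans (le_of_eq ?_) (ENNReal.ofReal_le_ofReal hreal)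
  rw [ENNReal.ofReal_div_of_pos hPpos', ENNReal.ofReal_natCast, ENNReal.ofReal_natCast]

theorem prob_pair_le (g : SpongeParameters) {q r : ℕ × (Fin 3 → ℕ)} (hqr : q ≠ r)
    (B : Finset (Fin 3 → ℕ) → Finset (Fin 3 → ℕ) → Prop) {ε : ENNReal}
    (h : ∀ F : g.Choice q, g.choiceLaw r {G | B F.1 G.1} ≤ ε) :
    g.prob {ω | B (ω q).1 (ω r).1} ≤ ε := by
  have : MeasurableSingletonClass (g.Choice q) := ⟨fun _ => MeasurableSpace.measurableSet_top⟩
  exact Measure.infinitePi_pair_le g.choiceLaw hqr (fun F => {G | B F.1 G.1})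
    (fun F => MeasurableSpace.measurableSet_top) h

/-- All factors lie in [0, 1], so each partial product containing this factor is bounded by it. -/
theorem lim_le_p_succ (g : SpongeParameters) (i : ℕ) : g.lim ≤ g.p (i + 1) := by
  have h01 : ∀ j, (0 : ℝ) ≤ g.p j ∧ (g.p j : ℝ) ≤ 1 := fun j => by
    cases j with
    | zero => simp [g.p_zero]
    | succ j => exact ⟨by exact_mod_cast (g.p_succ_mem j).1.le,
        by exact_mod_cast (g.p_succ_mem j).2.le⟩
  refine le_of_tendsto g.tendsto_prod (eventually_atTop.2 ⟨i + 1, fun n hn => ?_⟩)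
  rw [← Finset.mul_prod_erase _ _ (Finset.mem_range.2 (Nat.lt_succ_of_le hn))]
  exact mul_le_of_le_one_right (h01 _).1
    (Finset.prod_le_one (fun j _ => (h01 j).1) fun j _ => (h01 j).2)

/-- Once the choice F in a is fixed, T is a fixed set. Either it is too small and the event is
empty, or the choice in b must contain a large T; `density` turns the size of T into the exponent.
-/
theorem prob_absorbs_le (g : SpongeParameters) (i : ℕ) {a b : Fin 3 → ℕ} (hab : a ≠ b)
    (φ : (Fin 3 → ℕ) → Fin 3 → ℕ) :
    g.prob {ω | g.Absorbs i b φ (ω (i, a)).1 (ω (i, b)).1} ≤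
      ENNReal.ofReal (Real.exp (-(g.lim * 7 ^ g.S i * 8 ^ g.s (i + 1) /
        (125 * 64 ^ g.S i)))) := by
  have hab' : (i, a) ≠ (i, b) := fun h => hab (Prod.mk.inj h).2
  refine g.prob_pair_le hab' (g.Absorbs i b φ) fun F => ?_
  set T := F.1.image φ ∩ subcubes (g.s (i + 1)) b with hT
  by_cases hbig : g.keep (i + 1) ≤ 125 * 8 ^ g.S i * T.card
  swap
  · have : {G : g.Choice (i, b) | g.Absorbs i b φ F.1 G.1} = ∅ :=
      Set.eq_empty_of_forall_notMem fun G hG => hbig hG.1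
    rw [this, measure_empty]
    exact zero_le
  refine (measure_mono fun G hG => hG.2).trans
    ((g.choiceLaw_superset_le (i, b) (T := T) Finset.inter_subset_right).trans
      (ENNReal.ofReal_le_ofReal (Real.exp_le_exp.2 (neg_le_neg ?_))))
  have hkeep : (g.keep (i + 1) : ℝ) = g.p (i + 1) * 8 ^ g.s (i + 1) := by
    exact_mod_cast congrArg (Rat.cast : ℚ → ℝ) (g.keep_cast (i + 1))
  have h1 : g.lim * 8 ^ g.s (i + 1) ≤ 125 * 8 ^ g.S i * T.card := by
    calc g.lim * 8 ^ g.s (i + 1) ≤ g.p (i + 1) * 8 ^ g.s (i + 1) := by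
          gcongr; exact g.lim_le_p_succ i
      _ = g.keep (i + 1) := hkeep.symm
      _ ≤ _ := by exact_mod_cast hbig
  have h2 : (7 : ℝ) ^ g.S i ≤ (1 - g.p (i + 1)) * 8 ^ g.S i := by exact_mod_cast g.density i
  rw [div_le_iff₀ (by positivity)]
  calc g.lim * 7 ^ g.S i * 8 ^ g.s (i + 1) = 7 ^ g.S i * (g.lim * 8 ^ g.s (i + 1)) := by ring
    _ ≤ ((1 - g.p (i + 1)) * 8 ^ g.S i) * (125 * 8 ^ g.S i * T.card) := by
      have := g.lim_mem.1
      refine mul_le_mul h2 h1 (by positivity) (le_trans (by positivity) h2)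
    _ = (1 - g.p (i + 1)) * T.card * (125 * (8 * 8) ^ g.S i) := by rw [mul_pow]; ring
    _ = _ := by norm_num

theorem prob_containsSubcongruentCube_le (g : SpongeParameters) {S i : ℕ} (hS : S ≤ g.S i) :
    g.prob.real {ω | ContainsSubcongruentCube S (g.randomComplex (i + 1) ω)} ≤
      8 ^ g.S i * (8 ^ g.S i * (2 ^ (12 * (g.S i + g.s (i + 1)) + 132) *
        Real.exp (-(g.lim * 7 ^ g.S i * 8 ^ g.s (i + 1) / (125 * 64 ^ g.S i))))) := by
  set e := Real.exp (-(g.lim * 7 ^ g.S i * 8 ^ g.s (i + 1) / (125 * 64 ^ g.S i))) with he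
  refine ENNReal.toReal_le_of_le_ofReal (by positivity) ?_
  have hsub : {ω | ContainsSubcongruentCube S (g.randomComplex (i + 1) ω)} ⊆
      ⋃ a ∈ gridCubes (g.S i), ⋃ b ∈ gridCubes (g.S i), ⋃ φ ∈ gridMaps (g.S (i + 1)),
        {ω | a ≠ b ∧ g.Absorbs i b φ (ω (i, a)).1 (ω (i, b)).1} := by
    intro ω hω
    obtain ⟨a, ha, b, hb, φ, hφ, h⟩ := g.exists_absorbs_of_containsSubcongruentCube hS ω hω
    simp only [Set.mem_iUnion]
    exact ⟨a, ha, b, hb, φ, hφ, h⟩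
  have hevent : ∀ a b φ, g.prob {ω | a ≠ b ∧ g.Absorbs i b φ (ω (i, a)).1 (ω (i, b)).1} ≤
      ENNReal.ofReal e := fun a b φ => by
    by_cases hab : a = b
    · simp [hab]
    · exact (measure_mono fun ω h => h.2).trans (g.prob_absorbs_le i hab φ)
  calc _ ≤ _ := measure_mono hsub
    _ ≤ ∑ a ∈ gridCubes (g.S i), ∑ b ∈ gridCubes (g.S i), ∑ φ ∈ gridMaps (g.S (i + 1)),
        g.prob {ω | a ≠ b ∧ g.Absorbs i b φ (ω (i, a)).1 (ω (i, b)).1} :=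
      (measure_biUnion_finset_le _ _).trans (Finset.sum_le_sum fun a _ =>
        (measure_biUnion_finset_le _ _).trans (Finset.sum_le_sum fun b _ =>
          measure_biUnion_finset_le _ _))
    _ ≤ ∑ a ∈ gridCubes (g.S i), ∑ b ∈ gridCubes (g.S i), ∑ φ ∈ gridMaps (g.S (i + 1)),
        ENNReal.ofReal e :=
      Finset.sum_le_sum fun a _ => Finset.sum_le_sum fun b _ => Finset.sum_le_sum fun φ _ =>
        hevent a b φ
    _ = ENNReal.ofReal (8 ^ g.S i * (8 ^ g.S i * ((gridMaps (g.S (i + 1))).card * e))) := by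
      simp only [Finset.sum_const, card_gridCubes, nsmul_eq_mul]
      rw [ENNReal.ofReal_mul (by positivity), ENNReal.ofReal_mul (by positivity),
        ENNReal.ofReal_mul (by positivity), ENNReal.ofReal_natCast]
      simp [ENNReal.ofReal_pow]
    _ ≤ _ := by
      refine ENNReal.ofReal_le_ofReal ?_
      have h : ((gridMaps (g.S (i + 1))).card : ℝ) ≤ 2 ^ (12 * (g.S i + g.s (i + 1)) + 132) := by
        rw [← g.S_succ]
        exact_mod_cast card_gridMaps_le (g.S (i + 1))
      gcongr

end SpongeParameters

/-- The double exponential decay beats the number of discretized isometries. -/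
theorem exists_forall_union_bound_lt {l : ℝ} (hl : 0 < l) :
    ∃ n₀ : ℕ, ∀ n ≥ n₀, ∀ s ≥ 3 * 8 ^ n,
      (8 : ℝ) ^ n * (8 ^ n * (2 ^ (12 * (n + s) + 132) *
        Real.exp (-(l * 7 ^ n * 8 ^ s / (125 * 64 ^ n))))) < 2 ^ (-((5 : ℤ) ^ (n + s))) := by
  -- Here 250 = 2 · 125: the 2 comes from m ≤ 2 · 5^(n+s), the 125 from the multiplicity of the
  -- label maps.
  obtain ⟨n₀, hn₀⟩ := pow_unbounded_of_one_lt (250 / l) (one_lt_two : (1 : ℝ) < 2)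
  refine ⟨n₀ + 1, fun n hn s hs => ?_⟩
  have hn8 : 1 + n * 7 ≤ 8 ^ n := by
    clear hn hs
    induction n with
    | zero => simp
    | succ n ih => rw [pow_succ]; omega
  have hs12 : 12 * n ≤ s := by omega
  have hlin : ∀ k : ℕ, 4 ≤ k → 18 * k + 133 ≤ 5 ^ k := fun k hk => by
    induction k, hk using Nat.le_induction with
    | base => norm_num
    | succ k hk ih => rw [pow_succ]; omega
  have hm : 18 * n + 12 * s + 133 ≤ 5 ^ (n + s) := le_trans (by omega) (hlin (n + s) (by omega))
  -- The prefactor is 2^(18n+12s+132); one further power of 2 makes the final inequality strict.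
  set m : ℕ := 18 * n + 12 * s + 133 + 5 ^ (n + s) with hmdef
  have hm2 : (m : ℝ) ≤ 2 * (5 ^ n * 5 ^ s) := by
    rw [← pow_add]
    exact_mod_cast (by omega : m ≤ 2 * 5 ^ (n + s))
  -- The base 46 is enough because 7 · 46 ≥ 5 · 64. As (8/5)^12 ≥ 2 · 46, a factor 2^n is left over
  -- to absorb 250/l.
  have hratio : (8 / 5 : ℝ) ^ s ≥ 250 / l * 46 ^ n := by
    calc (8 / 5 : ℝ) ^ s ≥ (8 / 5) ^ (12 * n) := pow_le_pow_right₀ (by norm_num) hs12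
      _ = ((8 / 5) ^ 12) ^ n := pow_mul _ _ _
      _ ≥ (2 * 46) ^ n := pow_le_pow_left₀ (by norm_num) (by norm_num) n
      _ = 2 ^ n * 46 ^ n := mul_pow _ _ _
      _ ≥ 250 / l * 46 ^ n := by
        gcongr
        exact hn₀.le.trans (pow_le_pow_right₀ one_le_two (by omega))
  have hx : (m : ℝ) ≤ l * 7 ^ n * 8 ^ s / (125 * 64 ^ n) := by
    refine hm2.trans ?_
    rw [le_div_iff₀ (by positivity)]
    have h8 : (8 : ℝ) ^ s = (8 / 5) ^ s * 5 ^ s := by rw [← mul_pow]; norm_num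
    calc 2 * ((5 : ℝ) ^ n * 5 ^ s) * (125 * 64 ^ n) = 250 * (5 * 64) ^ n * 5 ^ s := by
          rw [mul_pow]; ring
      _ ≤ 250 * (7 * 46) ^ n * 5 ^ s := by
        have : (5 * 64 : ℝ) ^ n ≤ (7 * 46) ^ n := pow_le_pow_left₀ (by norm_num) (by norm_num) n
        gcongr
      _ = l * 7 ^ n * (250 / l * 46 ^ n * 5 ^ s) := by rw [mul_pow]; field_simp
      _ ≤ l * 7 ^ n * ((8 / 5) ^ s * 5 ^ s) := by gcongr
      _ = _ := by rw [h8]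
  have hexp : Real.exp (-(l * 7 ^ n * 8 ^ s / (125 * 64 ^ n))) ≤ (2 ^ m)⁻¹ := by
    rw [Real.exp_neg]
    refine inv_anti₀ (by positivity) ?_
    calc (2 : ℝ) ^ m ≤ (Real.exp 1) ^ m := by
          gcongr
          linarith [Real.add_one_le_exp (1 : ℝ)]
      _ = Real.exp m := by rw [← Real.exp_nat_mul, mul_one]
      _ ≤ _ := Real.exp_le_exp.2 hx
  have hz : (2 : ℝ) ^ (-((5 : ℤ) ^ (n + s))) = (2 ^ 5 ^ (n + s))⁻¹ := by
    rw [zpow_neg]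
    norm_cast
  rw [hz]
  calc _ ≤ (8 : ℝ) ^ n * (8 ^ n * (2 ^ (12 * (n + s) + 132) * (2 ^ m)⁻¹)) := by gcongr
    _ = 2 ^ (18 * n + 12 * s + 132) * (2 ^ m)⁻¹ := by
      have h8 : (8 : ℝ) ^ n = 2 ^ (3 * n) := by rw [pow_mul]; norm_num
      rw [h8, ← mul_assoc, ← mul_assoc, ← pow_add, ← pow_add]
      congr 2
      ring
    _ = (2 * 2 ^ 5 ^ (n + s))⁻¹ := by
      rw [hmdef]
      have : 18 * n + 12 * s + 133 + 5 ^ (n + s) = (18 * n + 12 * s + 132) + (1 + 5 ^ (n + s)) := by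
        ring
      rw [this, pow_add _ (18 * n + 12 * s + 132), mul_inv, ← mul_assoc,
        mul_inv_cancel₀ (by positivity), one_mul, pow_add, pow_one]
    _ < _ := by
      refine inv_strictAnti₀ (by positivity) ?_
      have : (0 : ℝ) < 2 ^ 5 ^ (n + s) := by positivity
      linarith

theorem mainTheorem4 (g : SpongeParameters) (S : ℕ) :
    ∃ i₀ : ℕ, ∀ i : ℕ, i₀ < i →
      g.prob.real {ω | ContainsSubcongruentCube S (g.randomComplex i ω)} <
        (2 : ℝ) ^ (-((5 : ℤ) ^ g.S i)) := by
  obtain ⟨n₀, hn₀⟩ := exists_forall_union_bound_lt g.lim_mem.1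
  refine ⟨max S n₀, fun i hi => ?_⟩
  obtain ⟨i, rfl⟩ := Nat.exists_eq_succ_of_ne_zero (Nat.ne_zero_of_lt hi)
  -- The index is now the predecessor; it is at least `max S n₀`, and S_i exceeds i.
  have hSi := g.lt_S i
  have h1 : S ≤ g.S i := by have := le_max_left S n₀; omega
  have h2 : n₀ ≤ g.S i := by have := le_max_right S n₀; omega
  rw [Nat.succ_eq_add_one, g.S_succ]
  exact (g.prob_containsSubcongruentCube_le h1).trans_lt (hn₀ _ h2 _ (g.growth i))
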